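/- Let $q$ be a prime power, $m\ge 2$ an integer, $\lambda$ a positive divisor of $q-1$ with $\lambda\neq q-1$, $s$ an integer with $1\le s\le \frac{q-1}{\lambda}-1$, and $n=\frac{q^m-1}{\lambda}$. Let $\beta\in\mathbb F_{q^m}$ be a primitive $n$-th root of unity. For $2\le\delta\le n$ let $\mathcal C_\delta$ be the narrow-sense BCH code over $\mathbb F_q$ of length $n$ and designed distance $\delta$, that is, the cyclic code of length $n$ whose generator polynomial is the least common multiple of the minimal polynomials over $\mathbb F_q$ of $\beta,\beta^2,\dots,\beta^{\delta-1}$, and let $\mathcal C_\delta^\perp$ be its Euclidean dual. Let $A=(a_{ij})$ be a nonsingular $2\times2$ matrix over $\mathbb F_q$ and let $$\mathcal C'_\delta=[\mathcal C_\delta^\perp,\mathcal C_\delta]A=\{(a_{11}u+a_{21}v\,|\,a_{12}u+a_{22}v): u\in\mathcal C_\delta^\perp,\ v\in\mathcal C_\delta\}\subseteq\mathbb F_q^{2n}.$$ Then $\mathcal C'_\delta$ is a linear code of length $2n$ and dimension $n$. Suppose moreover that $m$ is odd and that both entries $a_{11},a_{12}$ of the first row of $A$ are nonzero. Let $d(\mathcal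 C'_\delta)$ denote the minimum Hamming distance of $\mathcal C'_\delta$. (a) If $\delta=\frac{q^{(m+1)/2}-q}{\lambda}+s+1$ and $\frac q2<\lambda s\le q-\sqrt{\lambda q/2}$, then $$d(\mathcal C'_\delta)\ \ge\ 2\Big(\frac{q^{(m+1)/2}+\lambda-1}{\lambda}-s\,q^{(m-1)/2}\Big)\ >\ \sqrt{2n}.$$ (b) $d(\mathcal C'_\delta)\ge\delta>\sqrt{2n}$ if one of the following holds: 1. $\delta=\frac{q^{(m+1)/2}-q}{\lambda}+s+1$ and $\lambda s\le \frac q2$; 2. $\lambda s-\lambda+1\ge\sqrt{2\lambda q}$ and $\frac{q^{(m-1)/2}-1}{\lambda}+(s-1)q^{(m-1)/2}<\delta<\frac{q^{(m-1)/2}-1-\lambda}{\lambda}+s\,q^{(m-1)/2}$; 3. $q>\sqrt{4\lambda q+\lambda^2}$ and $\frac{q^{(m+1)/2}-1}{\lambda}-q^{(m-1)/2}<\delta\le\frac{q^{(m+1)/2}-q}{\lambda}+1$; 4. $\lambda=1$, $q\ge5$, $\sqrt{2q}\le s<q-2$ and $s\,q^{(m-1)/2}\le\delta\le(s+1)q^{(m-1)/2}-s\,q^{(m-3)/2}-2$.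 -/

import Mathlib

open Polynomial

noncomputable section

namespace BCH

/-- The polynomial `c₀ + c₁ X + ⋯ + c_{n-1} X^{n-1}` attached to a vector `c ∈ F ^ n`. -/
def vecPoly (F : Type*) [Field F] (n : ℕ) : (Fin n → F) →ₗ[F] F[X] where
  toFun c := ∑ i : Fin n, C (c i) * X ^ (i : ℕ)
  map_add' c d := by simp [add_mul, Finset.sum_add_distrib]
  map_smul' a c := by simp [Finset.smul_sum, mul_assoc, smul_eq_C_mul]

/-- The cyclic code of length `n` over `F` generated by `g`: all vectors whose polynomial lies,
modulo `X ^ n - 1`, in the ideal of `F[X] / (X ^ n - 1)` generated by `g`. -/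
def cyclicCode (F : Type*) [Field F] (n : ℕ) (g : F[X]) : Submodule F (Fin n → F) :=
  ((Ideal.span {Ideal.Quotient.mk (Ideal.span {(X ^ n - 1 : F[X])}) g}).restrictScalars F).comap
    ((Ideal.Quotient.mkₐ F (Ideal.span {(X ^ n - 1 : F[X])})).toLinearMap ∘ₗ vecPoly F n)

/-- The (monic) least common multiple of the minimal polynomials over `F` of
`β, β ^ 2, …, β ^ (δ - 1)`. -/
def genPoly (F : Type*) [Field F] {K : Type*} [Field K] [Algebra F K] (β : K) (δ : ℕ) : F[X] :=
  letI : DecidableEq F := Classical.decEq F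
  letI : NormalizedGCDMonoid F[X] := UniqueFactorizationMonoid.toNormalizedGCDMonoid F[X]
  (Finset.Icc 1 (δ - 1)).lcm fun i => minpoly F (β ^ i)

/-- The narrow-sense BCH code over `F` of length `n` and designed distance `δ` with respect to
`β` (a primitive `n`-th root of unity in an extension field of `F`). -/
def narrowSenseBCH (F : Type*) [Field F] {K : Type*} [Field K] [Algebra F K]
    (n : ℕ) (β : K) (δ : ℕ) : Submodule F (Fin n → F) :=
  cyclicCode F n (genPoly F β δ)

/-- The Euclidean dual of a linear code. -/
def dualCode {F : Type*} [Field F] {n : ℕ} (C : Submodule F (Fin n → F)) :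
    Submodule F (Fin n → F) where
  carrier := {b | ∀ c ∈ C, b ⬝ᵥ c = 0}
  zero_mem' c _ := zero_dotProduct c
  add_mem' {a b} ha hb c hc := by rw [add_dotProduct, ha c hc, hb c hc, add_zero]
  smul_mem' r a ha c hc := by rw [smul_dotProduct, ha c hc, smul_zero]

/-- The matrix-product code `[C₁, …, C_s] A ⊆ F ^ (t n)` for an `s × t` matrix `A`. Its words are
the concatenations of `t` blocks of length `n`, the `j`-th block being `∑ i, A i j • c i`, where
`c i` ranges over `C i`. -/
def matrixProductCode {F : Type*} [Field F] {s t n : ℕ} (C : Fin s → Submodule F (Fin n → F))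
    (A : Matrix (Fin s) (Fin t) F) : Submodule F (Fin (t * n) → F) where
  carrier := {w | ∃ c : Fin s → Fin n → F, (∀ i, c i ∈ C i) ∧
    ∀ (j : Fin t) (x : Fin n), w (finProdFinEquiv (j, x)) = ∑ i, A i j * c i x}
  zero_mem' := ⟨0, fun i => (C i).zero_mem, by simp⟩
  add_mem' := by
    rintro v w ⟨c, hc, hv⟩ ⟨d, hd, hw⟩
    exact ⟨c + d, fun i => (C i).add_mem (hc i) (hd i), fun j x => by
      simp [hv, hw, mul_add, Finset.sum_add_distrib]⟩
  smul_mem' := by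
    rintro r w ⟨c, hc, hw⟩
    exact ⟨r • c, fun i => (C i).smul_mem r (hc i), fun j x => by
      simp [hw, Finset.mul_sum, mul_left_comm]⟩

/-- The minimum Hamming distance of a linear code with at least two words. -/
def minDist {F : Type*} [Field F] [DecidableEq F] {N : ℕ} (C : Submodule F (Fin N → F)) : ℕ :=
  sInf {d | ∃ x ∈ C, ∃ y ∈ C, x ≠ y ∧ hammingDist x y = d}

end BCH

end

namespace BCH

/-! ### Cyclic codes, the BCH bound and zeros of dual words. -/

section CyclicCode

variable {F : Type*} [Field F] {n : ℕ}

/-! Write `C` for the BCH code, `m = 2h + 1` and `Q = q ^ h`. As `A` is invertible, a word of the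
product determines `u` and `v`, so the dimensions of `C^⊥` and `C` add up to `n`. For the distance,
if `v = 0` both blocks are nonzero multiples of `u`. If `v ≠ 0`, each position in the support of `v`
is nonzero in at least one block, so the weight is at least that of `v`, which is at least `δ` by
the BCH bound.

It remains to bound the weight of `u` in `C^⊥`. Such a `u` vanishes at `β ^ j` unless `β ^ (-j)` is
conjugate to some `β ^ i` with `1 ≤ i < δ`, that is, unless `n ∣ i q^k + j`. Multiplied by `λ`, the
modulus becomes `q^m - 1`, where multiplication by `q` rotates base-`q` digits. Since `λ i` has at
most `h + 1` of the `2h + 1` digits, its rotations stay away from `q^m - 1`, and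
`not_dvd_mul_pow_add` excludes all small `j`. The BCH bound for the zeros `β^0, β^1, …` then gives
`le_mul_hammingNorm_of_mem_dualCode`. The rest is real arithmetic with `λ n = q Q^2 - 1`. -/

theorem vecPoly_apply (c : Fin n → F) :
    vecPoly F n c = ∑ i : Fin n, C (c i) * X ^ (i : ℕ) := rfl

theorem vecPoly_coeff_of_natDegree_lt {p : F[X]} (hp : p.natDegree < n) :
    vecPoly F n (fun i => p.coeff i) = p := by
  rw [vecPoly_apply, Fin.sum_univ_eq_sum_range (fun i => C (p.coeff i) * X ^ i) n]
  exact (p.as_sum_range_C_mul_X_pow' hp).symm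

theorem aeval_vecPoly {K : Type*} [Field K] [Algebra F K] (c : Fin n → F) (x : K) :
    aeval x (vecPoly F n c) = ∑ i : Fin n, algebraMap F K (c i) * x ^ (i : ℕ) := by
  simp [vecPoly_apply]

theorem mem_cyclicCode {g : F[X]} {c : Fin n → F} :
    c ∈ cyclicCode F n g ↔
      ∃ r s : F[X], vecPoly F n c = r * g + s * (X ^ n - 1) := by
  have : c ∈ cyclicCode F n g ↔
      Ideal.Quotient.mk (Ideal.span {(X ^ n - 1 : F[X])}) (vecPoly F n c) ∈
        Ideal.span {Ideal.Quotient.mk (Ideal.span {(X ^ n - 1 : F[X])}) g} := Iff.rfl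
  rw [this, Ideal.mem_span_singleton']
  constructor
  · rintro ⟨a, ha⟩
    obtain ⟨r, rfl⟩ := Ideal.Quotient.mk_surjective a
    rw [← map_mul, eq_comm, Ideal.Quotient.eq, Ideal.mem_span_singleton'] at ha
    obtain ⟨s, hs⟩ := ha
    exact ⟨r, s, by rw [hs]; ring⟩
  · rintro ⟨r, s, h⟩
    refine ⟨Ideal.Quotient.mk _ r, ?_⟩
    rw [← map_mul, eq_comm, Ideal.Quotient.eq, Ideal.mem_span_singleton']
    exact ⟨s, by rw [h]; ring⟩

theorem mem_cyclicCode_of_dvd {g : F[X]} {c : Fin n → F} (h : g ∣ vecPoly F n c) :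
    c ∈ cyclicCode F n g := by
  obtain ⟨r, hr⟩ := h
  exact mem_cyclicCode.2 ⟨r, 0, by rw [hr]; ring⟩

theorem dvd_vecPoly_of_mem_cyclicCode {g : F[X]} (hg : g ∣ X ^ n - 1) {c : Fin n → F}
    (hc : c ∈ cyclicCode F n g) : g ∣ vecPoly F n c := by
  obtain ⟨r, s, h⟩ := mem_cyclicCode.1 hc
  rw [h]
  exact dvd_add (dvd_mul_left _ _) (hg.mul_left _)

/-- The BCH bound: a nonzero word whose polynomial vanishes at `r` consecutive powers of a
primitive `n`-th root of unity has weight more than `r`. -/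
theorem lt_hammingNorm_of_aeval_eq_zero [DecidableEq F] {K : Type*} [Field K] [Algebra F K]
    {β : K} (hβ : IsPrimitiveRoot β n) {c : Fin n → F} (hc : c ≠ 0) (b r : ℕ)
    (h : ∀ j < r, aeval (β ^ (b + j)) (vecPoly F n c) = 0) : r < hammingNorm c := by
  classical
  by_contra! hr
  obtain ⟨i₀, hi₀⟩ := Function.ne_iff.1 hc
  set S : Finset (Fin n) := Finset.univ.filter fun i => c i ≠ 0 with hS
  have hcard : S.card ≤ r := hr
  have hmem : i₀ ∈ S := by simpa [hS] using hi₀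
  have key : ∀ P : K[X], P.natDegree < r →
      ∑ i : Fin n, algebraMap F K (c i) * (β ^ b) ^ (i : ℕ) * P.eval (β ^ (i : ℕ)) = 0 := by
    intro P hP
    simp_rw [eval_eq_sum_range' hP, Finset.mul_sum]
    rw [Finset.sum_comm]
    refine Finset.sum_eq_zero fun j hj => ?_
    have := h j (Finset.mem_range.1 hj)
    rw [aeval_vecPoly] at this
    calc _ = P.coeff j * ∑ i : Fin n, algebraMap F K (c i) * (β ^ (b + j)) ^ (i : ℕ) := by
          rw [Finset.mul_sum]
          refine Finset.sum_congr rfl fun i _ => ?_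
          rw [pow_add, mul_pow, ← pow_mul, ← pow_mul, ← pow_mul, mul_comm j]
          ring
      _ = 0 := by rw [this, mul_zero]
  -- This replaces a Vandermonde determinant: `P` kills every support point except `i₀`, and its
  -- degree is below `r` because the support has at most `r` points.
  set P : K[X] := ∏ i ∈ S.erase i₀, (X - C (β ^ (i : ℕ))) with hP
  have hdeg : P.natDegree < r := by
    rw [hP, natDegree_prod_of_monic _ _ fun i _ => monic_X_sub_C _]
    simp only [natDegree_X_sub_C, Finset.sum_const, smul_eq_mul, mul_one]
    exact (Finset.card_erase_lt_of_mem hmem).trans_le hcard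
  have hsum := key P hdeg
  rw [Finset.sum_eq_single i₀] at hsum
  · have hn : n ≠ 0 := by have := i₀.2; omega
    have hβ0 : β ≠ 0 := hβ.ne_zero hn
    have hev : P.eval (β ^ (i₀ : ℕ)) ≠ 0 := by
      rw [hP, eval_prod, Finset.prod_ne_zero_iff]
      intro i hi
      rw [eval_sub, eval_X, eval_C, sub_ne_zero]
      intro he
      exact (Finset.ne_of_mem_erase hi) (Fin.ext (hβ.pow_inj i₀.2 i.2 he)).symm
    have h1 : algebraMap F K (c i₀) ≠ 0 := by simpa using hi₀
    exact mul_ne_zero (mul_ne_zero h1 (pow_ne_zero _ (pow_ne_zero _ hβ0))) hev hsum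
  · intro i _ hi
    by_cases hci : c i = 0
    · simp [hci]
    · have : P.eval (β ^ (i : ℕ)) = 0 := by
        rw [hP, eval_prod]
        refine Finset.prod_eq_zero (i := i) (by simp [hS, hi, hci]) (by simp)
      rw [this, mul_zero]
  · simp

/-- A word of the dual of a cyclic code vanishes at the inverses of the `n`-th roots of unity
that are not roots of the generator polynomial. -/
theorem aeval_vecPoly_eq_zero_of_mem_dualCode {K : Type*} [Field K] [Algebra F K] {g : F[X]}
    (hg : g ∣ X ^ n - 1) {γ : K} (hγ : γ ^ n = 1) (hn : n ≠ 0)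
    (hgγ : aeval γ⁻¹ g ≠ 0) {u : Fin n → F} (hu : u ∈ dualCode (cyclicCode F n g)) :
    aeval γ (vecPoly F n u) = 0 := by
  have hγ0 : γ ≠ 0 := by
    rintro rfl
    simp [hn] at hγ
  -- `W = (X^n - 1)/(γX - 1)` has coefficient vector `(γ^i)`. As `γ⁻¹` is not a root of `g`, `G`
  -- divides `W`, so this vector lies in the code extended to `K`, and its pairing with `u` is the
  -- value at `γ`.
  set W : K[X] := ∑ i ∈ Finset.range n, (C γ * X) ^ i with hW
  set G : K[X] := g.map (algebraMap F K) with hG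
  have hXn : (X ^ n - 1 : K[X]) ≠ 0 := X_pow_sub_C_ne_zero (Nat.pos_of_ne_zero hn) 1
  have hmulW : (C γ * X - 1) * W = X ^ n - 1 := by
    rw [hW, mul_geom_sum, mul_pow, ← C_pow, hγ, C_1, one_mul]
  have hGX : G ∣ X ^ n - 1 := by
    simpa [hG] using Polynomial.map_dvd (algebraMap F K) hg
  have hlin : C γ * X - 1 = C γ * (X - C γ⁻¹) := by
    rw [mul_sub, ← C_mul, mul_inv_cancel₀ hγ0, C_1]
  have hcop : IsCoprime G (C γ * X - 1) := by
    rw [hlin, isCoprime_mul_unit_left_right (isUnit_C.2 hγ0.isUnit)]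
    refine IsCoprime.symm ((irreducible_X_sub_C _).coprime_iff_not_dvd.2 ?_)
    rw [dvd_iff_isRoot, IsRoot.def, hG, eval_map_algebraMap]
    exact hgγ
  obtain ⟨Q, hQ⟩ : G ∣ W := hcop.dvd_of_dvd_mul_left (hmulW ▸ hGX)
  have hW0 : W ≠ 0 := by
    rintro h
    rw [h, mul_zero] at hmulW
    exact hXn hmulW.symm
  have hWcoeff : ∀ i < n, W.coeff i = γ ^ i := by
    intro i hi
    have h : ∀ j, ((C γ * X : K[X]) ^ j).coeff i = if j = i then γ ^ j else 0 := fun j => by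
      rw [mul_pow, ← C_pow, coeff_C_mul, coeff_X_pow]
      simp [eq_comm]
    rw [hW, finsetSum_coeff, Finset.sum_congr rfl fun j _ => h j]
    simp [hi]
  have hWdeg : W.natDegree < n := by
    have h1 : (C γ * X - 1 : K[X]).natDegree = 1 := by
      rw [hlin, natDegree_C_mul hγ0, natDegree_X_sub_C]
    have h0 : (C γ * X - 1 : K[X]) ≠ 0 := by
      rintro h
      rw [h, zero_mul] at hmulW
      exact hXn hmulW.symm
    have h2 := congrArg natDegree hmulW
    rw [natDegree_mul h0 hW0, h1, ← C_1, natDegree_X_pow_sub_C] at h2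
    omega
  have hG0 : G ≠ 0 := by rintro h; rw [h, zero_mul] at hQ; exact hW0 hQ
  have hQ0 : Q ≠ 0 := by rintro h; rw [h, mul_zero] at hQ; exact hW0 hQ
  have hdeg : g.natDegree + Q.natDegree < n := by
    rw [hQ, natDegree_mul hG0 hQ0, hG, natDegree_map] at hWdeg
    exact hWdeg
  -- The shifts `X^k g` with `k ≤ deg Q` have degree below `n`, so they are codewords over `F`;
  -- their `K`-span contains `W = G Q`.
  have hshift : ∀ k ≤ Q.natDegree,
      ∑ i : Fin n, algebraMap F K (u i) * (G * X ^ k).coeff i = 0 := by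
    intro k hk
    have hlt : (g * X ^ k).natDegree < n := by
      refine lt_of_le_of_lt natDegree_mul_le ?_
      rw [natDegree_X_pow]
      omega
    have h1 := hu _ (mem_cyclicCode_of_dvd
      (by rw [vecPoly_coeff_of_natDegree_lt hlt]; exact dvd_mul_right g (X ^ k)))
    have h2 := congrArg (algebraMap F K) h1
    rw [dotProduct, map_sum, map_zero] at h2
    rw [← h2]
    refine Finset.sum_congr rfl fun i _ => ?_
    rw [map_mul, ← coeff_map, Polynomial.map_mul, Polynomial.map_pow, map_X]
  calc aeval γ (vecPoly F n u)
      = ∑ i : Fin n, algebraMap F K (u i) * W.coeff i := by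
        rw [aeval_vecPoly]
        exact Finset.sum_congr rfl fun i _ => by rw [hWcoeff i i.2]
    _ = ∑ i : Fin n, ∑ k ∈ Finset.range (Q.natDegree + 1),
          Q.coeff k * (algebraMap F K (u i) * (G * X ^ k).coeff i) := by
        refine Finset.sum_congr rfl fun i _ => ?_
        have : W = ∑ k ∈ Finset.range (Q.natDegree + 1), C (Q.coeff k) * (G * X ^ k) := by
          rw [hQ]
          conv_lhs => rw [Q.as_sum_range_C_mul_X_pow, Finset.mul_sum]
          exact Finset.sum_congr rfl fun k _ => by ring
        rw [this, finsetSum_coeff, Finset.mul_sum]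
        exact Finset.sum_congr rfl fun k _ => by rw [coeff_C_mul]; ring
    _ = 0 := by
        rw [Finset.sum_comm]
        refine Finset.sum_eq_zero fun k hk => ?_
        rw [← Finset.mul_sum, hshift k (Nat.lt_succ_iff.1 (Finset.mem_range.1 hk)), mul_zero]

end CyclicCode

/-! ### Roots of the generator polynomial. -/

section GenPoly

variable {F : Type*} [Field F] {K : Type*} [Field K] [Algebra F K]

theorem genPoly_dvd_iff {β : K} {δ : ℕ} {p : F[X]} :
    genPoly F β δ ∣ p ↔ ∀ i ∈ Finset.Icc 1 (δ - 1), minpoly F (β ^ i) ∣ p := by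
  unfold genPoly
  exact @Finset.lcm_dvd_iff _ _ _ (_) _ _ _

theorem genPoly_dvd_X_pow_sub_one {β : K} {n : ℕ} (hβ : β ^ n = 1) (δ : ℕ) :
    genPoly F β δ ∣ X ^ n - 1 := by
  refine genPoly_dvd_iff.2 fun i _ => minpoly.dvd _ _ ?_
  rw [map_sub, map_pow, aeval_X, map_one, ← pow_mul, mul_comm, pow_mul, hβ, one_pow, sub_self]

theorem aeval_genPoly_pow {β : K} {δ i : ℕ} (hi : i ∈ Finset.Icc 1 (δ - 1)) :
    aeval (β ^ i) (genPoly F β δ) = 0 :=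
  aeval_eq_zero_of_dvd_aeval_eq_zero (genPoly_dvd_iff.1 dvd_rfl i hi) (minpoly.aeval _ _)

/-- The roots of the generator polynomial are the conjugates of `β, β ^ 2, …, β ^ (δ - 1)`. -/
theorem exists_eq_pow_of_aeval_genPoly_eq_zero [Fintype F] [Finite K] {β x : K} {δ : ℕ}
    (hx : aeval x (genPoly F β δ) = 0) :
    ∃ i ∈ Finset.Icc 1 (δ - 1), ∃ k < Module.finrank F K,
      x = β ^ (i * Fintype.card F ^ k) := by
  have hdvd : genPoly F β δ ∣ ∏ i ∈ Finset.Icc 1 (δ - 1), minpoly F (β ^ i) :=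
    genPoly_dvd_iff.2 fun i hi => Finset.dvd_prod_of_mem (fun i => minpoly F (β ^ i)) hi
  have h0 := aeval_eq_zero_of_dvd_aeval_eq_zero hdvd hx
  rw [map_prod, Finset.prod_eq_zero_iff] at h0
  obtain ⟨i, hi, h0⟩ := h0
  have hconj : IsConjRoot F x (β ^ i) :=
    (isConjRoot_def.2 (minpoly.eq_of_irreducible_of_monic
      (minpoly.irreducible (Algebra.IsIntegral.isIntegral _)) h0
      (minpoly.monic (Algebra.IsIntegral.isIntegral _)))).symm
  obtain ⟨σ, hσ⟩ := isConjRoot_iff_exists_algEquiv.1 hconj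
  obtain ⟨k, rfl⟩ := (FiniteField.bijective_frobeniusAlgEquivOfAlgebraic_pow F K).2 σ
  refine ⟨i, hi, k, k.2, ?_⟩
  rw [← hσ, AlgEquiv.coe_pow, FiniteField.coe_frobeniusAlgEquivOfAlgebraic_iterate, pow_mul]

end GenPoly

/-! ### Dimension and distance of matrix-product codes. -/

section MatrixProduct

variable {F : Type*} [Field F] {n : ℕ}

theorem finrank_add_finrank_dualCode (C : Submodule F (Fin n → F)) :
    Module.finrank F (dualCode C) + Module.finrank F C = n := by
  have h : dualCode C = C.dualAnnihilator.comap (dotProductEquiv F (Fin n)).toLinearMap := by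
    ext u
    rw [Submodule.mem_comap, Submodule.mem_dualAnnihilator]
    exact Iff.rfl
  have h1 : Module.finrank F (dualCode C) = Module.finrank F C.dualAnnihilator := by
    rw [h]
    exact LinearEquiv.finrank_eq ((dotProductEquiv F (Fin n)).ofSubmodule' C.dualAnnihilator)
  rw [h1, add_comm, Subspace.finrank_add_finrank_dualAnnihilator_eq, Module.finrank_fin_fun]

theorem eq_zero_of_forall_sum_mul_eq_zero {s : ℕ} {A : Matrix (Fin s) (Fin s) F}
    (hA : IsUnit A.det) {y : Fin s → F} (h : ∀ j, ∑ i, A i j * y i = 0) : y = 0 := by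
  refine Matrix.eq_zero_of_vecMul_eq_zero hA.ne_zero (funext fun j => ?_)
  rw [Pi.zero_apply, ← h j, Matrix.vecMul, dotProduct]
  exact Finset.sum_congr rfl fun i _ => mul_comm (y i) (A i j)

theorem finrank_matrixProductCode {s : ℕ} (C : Fin s → Submodule F (Fin n → F))
    {A : Matrix (Fin s) (Fin s) F} (hA : IsUnit A.det) :
    Module.finrank F (matrixProductCode C A) = ∑ i, Module.finrank F (C i) := by
  let T : (∀ i, C i) →ₗ[F] (Fin (s * n) → F) :=
    { toFun := fun c k =>
        ∑ i, A i (finProdFinEquiv.symm k).1 * (c i : Fin n → F) (finProdFinEquiv.symm k).2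
      map_add' := fun c d => by
        ext k
        simp [mul_add, Finset.sum_add_distrib]
      map_smul' := fun r c => by
        ext k
        simp [Finset.mul_sum, mul_left_comm] }
  have hTapply : ∀ c j x, T c (finProdFinEquiv (j, x)) = ∑ i, A i j * (c i : Fin n → F) x :=
    fun c j x => by
      simp only [T, LinearMap.coe_mk, AddHom.coe_mk, Equiv.symm_apply_apply]
  have hT : Function.Injective T := by
    rw [injective_iff_map_eq_zero]
    intro c hc
    have h : ∀ x : Fin n, (fun i => (c i : Fin n → F) x) = 0 := fun x =>
      eq_zero_of_forall_sum_mul_eq_zero hA fun j => (hTapply c j x).symm.trans (congrFun hc _)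
    ext i x
    exact congrFun (h x) i
  have hrange : matrixProductCode C A = LinearMap.range T := by
    ext w
    constructor
    · rintro ⟨c, hc, hw⟩
      refine ⟨fun i => ⟨c i, hc i⟩, funext fun k => ?_⟩
      obtain ⟨⟨j, x⟩, rfl⟩ := finProdFinEquiv.surjective k
      rw [hTapply, hw]
    · rintro ⟨c, rfl⟩
      exact ⟨fun i => c i, fun i => (c i).2, fun j x => hTapply c j x⟩
  rw [hrange, LinearMap.finrank_range_of_inj hT, Module.finrank_pi_fintype]

variable [DecidableEq F]

theorem hammingNorm_eq_sum_blocks {s : ℕ} (w : Fin (s * n) → F) :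
    hammingNorm w = ∑ j : Fin s, hammingNorm fun x : Fin n => w (finProdFinEquiv (j, x)) := by
  simp only [hammingNorm, Finset.card_filter]
  rw [← finProdFinEquiv.sum_comp, Fintype.sum_prod_type]

/-- The minimum distance of `[C₁, C₂] A`, for `A` nonsingular with a first row without zeros, is at
least twice the weight of a nonzero word of `C₁` or at least the weight of one of `C₂`. -/
theorem exists_hammingNorm_le_minDist_matrixProductCode (C : Fin 2 → Submodule F (Fin n → F))
    {A : Matrix (Fin 2) (Fin 2) F} (hA : IsUnit A.det) (h₀ : A 0 0 ≠ 0) (h₁ : A 0 1 ≠ 0)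
    (hne : matrixProductCode C A ≠ ⊥) :
    (∃ u ∈ C 0, u ≠ 0 ∧ 2 * hammingNorm u ≤ minDist (matrixProductCode C A)) ∨
      ∃ v ∈ C 1, v ≠ 0 ∧ hammingNorm v ≤ minDist (matrixProductCode C A) := by
  obtain ⟨w₀, hw₀, hw₀'⟩ := (Submodule.ne_bot_iff _).1 hne
  -- The code is nonzero, so the infimum is attained and is not the default value `0` of `sInf ∅`.
  obtain ⟨x, hx, y, hy, hxy, hd⟩ := Nat.sInf_mem
    (⟨_, w₀, hw₀, 0, Submodule.zero_mem _, hw₀', rfl⟩ : Set.Nonempty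
      {d | ∃ x ∈ matrixProductCode C A, ∃ y ∈ matrixProductCode C A, x ≠ y ∧ hammingDist x y = d})
  obtain ⟨c, hc, hw⟩ := (matrixProductCode C A).sub_mem hx hy
  have hd : hammingNorm (x - y) = minDist (matrixProductCode C A) :=
    by
    rw [sub_eq_neg_add, ← hammingDist_eq_hammingNorm, hammingDist_comm]
    exact hd
  have hw' : ∀ j : Fin 2, (fun z : Fin n => (x - y) (finProdFinEquiv (j, z))) =
      fun z => A 0 j * c 0 z + A 1 j * c 1 z := fun j => funext fun z => by
    rw [hw, Fin.sum_univ_two]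
  rw [← hd, hammingNorm_eq_sum_blocks, Fin.sum_univ_two, hw', hw']
  by_cases hv : c 1 = 0
  · left
    have hscale : ∀ j, A 0 j ≠ 0 →
        hammingNorm (fun z => A 0 j * c 0 z + A 1 j * c 1 z) = hammingNorm (c 0) := by
      intro j hj
      simp [hammingNorm, hv, hj]
    refine ⟨c 0, hc 0, ?_, ?_⟩
    · intro hu
      apply hxy
      rw [← sub_eq_zero]
      ext k
      obtain ⟨⟨j, z⟩, rfl⟩ := finProdFinEquiv.surjective k
      rw [hw, Fin.sum_univ_two, hu, hv]
      simp
    · rw [hscale 0 h₀, hscale 1 h₁, two_mul]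
  · right
    refine ⟨c 1, hc 1, hv, ?_⟩
    simp only [hammingNorm]
    refine le_trans (Finset.card_le_card ?_) (Finset.card_union_le _ _)
    intro z hz
    by_contra hcon
    simp only [Finset.mem_union, Finset.mem_filter, Finset.mem_univ, true_and, not_or,
      not_not] at hcon hz
    -- If both blocks vanish at `z`, invertibility of `A` forces `c 1 z = 0`.
    refine hz (congrFun (eq_zero_of_forall_sum_mul_eq_zero hA (y := fun i => c i z) ?_) 1)
    rw [Fin.forall_fin_two, Fin.sum_univ_two, Fin.sum_univ_two]
    exact hcon

end MatrixProduct

/-! ### Rotations of base-`q` digits modulo `q^m - 1`. -/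

/-- If `0 < a ≤ q ^ (h + 1) - q + t` and `J` is small, then `-J` is not a cyclic shift of `a`
modulo `q ^ (2 h + 1) - 1`. -/
theorem not_dvd_mul_pow_add {q h t B a J k : ℕ} (hq : 2 ≤ q) (hh : 1 ≤ h) (htq : t ≤ q - 1)
    (htB : t * q ^ h ≤ B) (hqB : q - 1 ≤ B) (ha : 0 < a) (ha' : a + q ≤ q ^ (h + 1) + t)
    (hJ : J + 1 + B < q ^ (h + 1)) (hk : k < 2 * h + 1) :
    ¬ q ^ (2 * h + 1) - 1 ∣ a * q ^ k + J := by
  have hq0 : 0 < q := by omega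
  have halt : a < q ^ (h + 1) := by omega
  have hmk : q ^ (2 * h + 1 - k) * q ^ k = q ^ (2 * h + 1) := by
    rw [← pow_add]; congr 1; omega
  set M := q ^ (2 * h + 1 - k) with hM
  set R := q ^ (2 * h + 1) with hR
  have hM0 : 0 < M := by positivity
  have hk0 : 0 < q ^ k := by positivity
  have hR2 : 2 * q ^ (h + 1) ≤ R := by
    calc 2 * q ^ (h + 1) ≤ q * q ^ (h + 1) := by gcongr
      _ = q ^ (h + 2) := by ring
      _ ≤ R := Nat.pow_le_pow_right hq0 (by omega)
  -- Splitting off the top `k` of the `2h + 1` digits: modulo `R - 1`, `a q^k` is `a₀ q^k + a₁`, the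
  -- digits rotated.
  obtain ⟨a₁, a₀, hdiv, ha₀M⟩ : ∃ a₁ a₀, M * a₁ + a₀ = a ∧ a₀ < M :=
    ⟨a / M, a % M, Nat.div_add_mod a M, Nat.mod_lt _ hM0⟩
  intro hdvd
  have hsplit : a * q ^ k + J = (R - 1) * a₁ + (a₀ * q ^ k + a₁ + J) := by
    obtain ⟨R', hR'⟩ : ∃ R', R = R' + 1 :=
      Nat.exists_eq_add_of_lt (show 0 < R by positivity) |>.imp fun _ h => by omega
    have h1 : a * q ^ k = R * a₁ + a₀ * q ^ k := by rw [← hdiv, ← hmk]; ring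
    rw [h1, hR', Nat.add_sub_cancel]; ring
  rw [hsplit, Nat.dvd_add_right (dvd_mul_right _ _)] at hdvd
  have hpos : 0 < a₀ * q ^ k + a₁ + J := by
    by_contra! hcon
    have h1 : a₁ = 0 := by omega
    have h2 : a₀ * q ^ k = 0 := by omega
    rw [h1, (Nat.mul_eq_zero.1 h2).resolve_right hk0.ne'] at hdiv
    omega
  have hge := Nat.le_of_dvd hpos hdvd
  have hq1 : q ≤ q ^ (h + 1) := Nat.le_self_pow (by omega) q
  -- A positive multiple would be at least `R - 1`; each case shows the rotated number plus `J` is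
  -- smaller. The tight cases are `k = h + 1`, which needs `q - 1 ≤ B`, and `k = h`, which needs `t
  -- q^h ≤ B`.
  rcases Nat.lt_or_ge h k with hkh | hkh
  · obtain ⟨l, rfl⟩ : ∃ l, k = h + 1 + l := ⟨k - (h + 1), by omega⟩
    have ha₁lt : a₁ < q ^ (l + 1) := by
      refine lt_of_mul_lt_mul_left (a := M) ?_ (Nat.zero_le M)
      calc M * a₁ ≤ a := by omega
        _ < q ^ (h + 1) := halt
        _ = M * q ^ (l + 1) := by rw [hM, ← pow_add]; congr 1; omega
    have h2 : a₀ * q ^ (h + 1 + l) + q ^ (h + 1 + l) ≤ R := by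
      rw [← hmk]
      calc _ = (a₀ + 1) * q ^ (h + 1 + l) := by ring
        _ ≤ _ := Nat.mul_le_mul_right _ ha₀M
    rcases Nat.eq_zero_or_pos l with rfl | hl
    · simp only [add_zero, zero_add, pow_one] at *
      omega
    · have h3 : q ^ (h + 1) + q ^ (l + 1) ≤ q ^ (h + 1 + l) := by
        calc q ^ (h + 1) + q ^ (l + 1) ≤ q ^ (h + l) + q ^ (h + l) :=
              Nat.add_le_add (Nat.pow_le_pow_right hq0 (by omega))
                (Nat.pow_le_pow_right hq0 (by omega))
          _ = 2 * q ^ (h + l) := by ring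
          _ ≤ q * q ^ (h + l) := by gcongr
          _ = q ^ (h + 1 + l) := by ring
      omega
  · have hM' : q ^ (h + 1) ≤ M := Nat.pow_le_pow_right hq0 (by omega)
    have ha₁0 : a₁ = 0 := by
      by_contra hne
      have := Nat.le_mul_of_pos_right M (Nat.pos_of_ne_zero hne)
      omega
    have ha₀a : a₀ = a := by rw [ha₁0, mul_zero, zero_add] at hdiv; exact hdiv
    rw [ha₁0, ha₀a] at hge
    rcases hkh.lt_or_eq with hkh | rfl
    · have h1 : a * q ^ k ≤ q ^ (2 * h) := by
        calc a * q ^ k ≤ q ^ (h + 1) * q ^ (h - 1) := by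
              gcongr
              omega
          _ = q ^ (2 * h) := by rw [← pow_add]; congr 1; omega
      have h2 : q ^ (2 * h) + q ^ (h + 1) ≤ R := by
        calc q ^ (2 * h) + q ^ (h + 1) ≤ q ^ (2 * h) + q ^ (2 * h) :=
              Nat.add_le_add_left (Nat.pow_le_pow_right hq0 (by omega)) _
          _ = 2 * q ^ (2 * h) := by ring
          _ ≤ q * q ^ (2 * h) := by gcongr
          _ = R := by rw [hR]; ring
      omega
    · have h1 : a * q ^ k + q ^ (k + 1) ≤ R + t * q ^ k := by
        calc a * q ^ k + q ^ (k + 1) = (a + q) * q ^ k := by ring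
          _ ≤ (q ^ (k + 1) + t) * q ^ k := by gcongr
          _ = R + t * q ^ k := by rw [hR]; ring
      omega

/-! ### Weights in the BCH code and in its dual. -/

section

variable {F K : Type*} [Field F] [DecidableEq F] [Field K] [Algebra F K]

/-- The BCH bound for narrow-sense BCH codes. -/
theorem le_hammingNorm_of_mem_narrowSenseBCH {n δ : ℕ} {β : K} (hβ : IsPrimitiveRoot β n)
    {v : Fin n → F} (hv : v ∈ narrowSenseBCH F n β δ) (hv0 : v ≠ 0) : δ ≤ hammingNorm v := by
  have h := lt_hammingNorm_of_aeval_eq_zero hβ hv0 1 (δ - 1) fun j hj =>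
    aeval_eq_zero_of_dvd_aeval_eq_zero
      (dvd_vecPoly_of_mem_cyclicCode (genPoly_dvd_X_pow_sub_one hβ.pow_eq_one δ) hv)
      (aeval_genPoly_pow (Finset.mem_Icc.2 ⟨by omega, by omega⟩))
  omega

/-- A lower bound for the weights of the dual of a narrow-sense BCH code. -/
theorem le_mul_hammingNorm_of_mem_dualCode [Fintype F] {q h lam n δ t B : ℕ} {β : K}
    (hq : Fintype.card F = q) (hK : Module.finrank F K = 2 * h + 1) (hh : 1 ≤ h)
    (hlam : 0 < lam) (hn : lam * n = q ^ (2 * h + 1) - 1) (hβ : IsPrimitiveRoot β n)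
    (hδ : lam * (δ - 1) + q ≤ q ^ (h + 1) + t) (htq : t ≤ q - 1) (htB : t * q ^ h ≤ B)
    (hqB : q - 1 ≤ B) {u : Fin n → F} (hu : u ∈ dualCode (narrowSenseBCH F n β δ)) (hu0 : u ≠ 0) :
    q ^ (h + 1) + lam ≤ lam * hammingNorm u + 1 + B := by
  have : Module.Finite F K := Module.finite_of_finrank_pos (by omega)
  have : Finite K := Module.finite_of_finite F
  have hq2 : 2 ≤ q := hq ▸ Fintype.one_lt_card
  have hn0 : n ≠ 0 := by
    rintro rfl
    have : q ≤ q ^ (2 * h + 1) := Nat.le_self_pow (by omega) q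
    omega
  by_contra! hlt
  -- If the weight `w` were below the bound, `u` would vanish at `β^0, …, β^(w-1)`, so its weight
  -- would exceed `w`.
  refine lt_irrefl _ (lt_hammingNorm_of_aeval_eq_zero hβ hu0 0 (hammingNorm u) fun j hj => ?_)
  refine aeval_vecPoly_eq_zero_of_mem_dualCode
    (genPoly_dvd_X_pow_sub_one hβ.pow_eq_one δ) ?_ hn0 ?_ hu
  · rw [← pow_mul, mul_comm, pow_mul, hβ.pow_eq_one, one_pow]
  · intro hroot
    obtain ⟨i, hi, k, hk, hik⟩ := exists_eq_pow_of_aeval_genPoly_eq_zero hroot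
    rw [Finset.mem_Icc] at hi
    rw [hq] at hik
    rw [hK] at hk
    have hβ0 := hβ.ne_zero hn0
    have h1 : β ^ (i * q ^ k + j) = 1 := by
      rw [pow_add, ← hik, zero_add, inv_mul_cancel₀ (pow_ne_zero _ hβ0)]
    have h2 : lam * n ∣ lam * i * q ^ k + lam * j := by
      have := Nat.mul_dvd_mul_left lam (hβ.dvd_of_pow_eq_one _ h1)
      rwa [mul_add, ← mul_assoc] at this
    rw [hn] at h2
    refine not_dvd_mul_pow_add hq2 hh htq htB hqB (Nat.mul_pos hlam (by omega)) ?_ ?_ hk h2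
    · have := Nat.mul_le_mul_left lam hi.2
      omega
    · have := Nat.mul_le_mul_left lam (show j + 1 ≤ hammingNorm u from hj)
      rw [mul_add] at this
      omega

end

/-! ### Comparison with `√(2n)`, where `Q` stands for `q^h` and `l` for `λ`. -/

section Arithmetic

variable {q l s d Q n : ℝ}

theorem sqrt_two_mul_lt {x : ℝ} (hl : 0 < l) (hn : l * n = q * Q ^ 2 - 1) (hx : 0 < l * x)
    (h : 2 * l * (q * Q ^ 2) ≤ (l * x) ^ 2) : √(2 * n) < x := by
  have hx0 : 0 < x := pos_of_mul_pos_right hx hl.le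
  rw [Real.sqrt_lt' hx0]
  refine lt_of_mul_lt_mul_left (a := l ^ 2) ?_ (by positivity)
  calc l ^ 2 * (2 * n) = 2 * l * (q * Q ^ 2) - 2 * l := by linear_combination 2 * l * hn
    _ < (l * x) ^ 2 := by linarith
    _ = l ^ 2 * x ^ 2 := by ring

/-- Since `l s ≥ l`, `l d ≥ Qq - (q - 2l)`. Squaring, the excess over `2 l q Q^2` is `(q - 2l) Qq (Q
- 2) + (q - 2l)^2 ≥ 0`. -/
theorem sqrt_lt_of_add_sub_eq (hq : 0 < q) (hl : 1 ≤ l) (hlq : 2 * l + 1 ≤ q) (hs : l ≤ l * s)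
    (hqQ : q ≤ Q) (hn : l * n = q * Q ^ 2 - 1) (hd : l * d = Q * q - q + l * s + l) :
    √(2 * n) < d := by
  have hQq : q * q ≤ Q * q := by gcongr
  have hlow : Q * q - (q - 2 * l) ≤ l * d := by linarith
  have hpos : 0 < Q * q - (q - 2 * l) := by nlinarith
  refine sqrt_two_mul_lt (by linarith) hn (hpos.trans_le hlow)
    (le_trans ?_ (pow_le_pow_left₀ hpos.le hlow 2))
  have h1 : 0 ≤ (q - 2 * l) * (Q * q) * (Q - 2) :=
    mul_nonneg (mul_nonneg (by linarith) (by nlinarith)) (by linarith)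
  nlinarith [sq_nonneg (q - 2 * l)]

/-- Serves every case where `l x` is at least a multiple `w Q` with `w^2 ≥ 2 l q`; the caller picks
`w`. -/
theorem sqrt_lt_of_sqrt_le (hq : 0 < q) (hl : 0 < l) (hQ : 0 < Q) {w x : ℝ}
    (hw : √(2 * l * q) ≤ w) (hn : l * n = q * Q ^ 2 - 1) (hd : w * Q ≤ l * x) :
    √(2 * n) < x := by
  have hsq : 0 < √(2 * l * q) := Real.sqrt_pos.2 (by positivity)
  have hw2 : 2 * l * q ≤ w ^ 2 := (Real.sqrt_le_left (hsq.trans_le hw).le).1 hw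
  have hpos : 0 < w * Q := mul_pos (hsq.trans_le hw) hQ
  refine sqrt_two_mul_lt hl hn (hpos.trans_le hd)
    (le_trans ?_ (pow_le_pow_left₀ hpos.le hd 2))
  calc 2 * l * (q * Q ^ 2) = (2 * l * q) * Q ^ 2 := by ring
    _ ≤ w ^ 2 * Q ^ 2 := by gcongr
    _ = (w * Q) ^ 2 := by ring

end Arithmetic

end BCH

/-! ### The main theorem. -/

theorem mainTheorem5 {F K : Type*} [Field F] [Fintype F] [DecidableEq F] [Field K] [Algebra F K]
    (q m lam s n δ : ℕ)
    (hq : Fintype.card F = q) (hK : Module.finrank F K = m) (hm : 2 ≤ m)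
    (hlam : lam ∣ q - 1) (hlam' : lam ≠ q - 1)
    (hs : 1 ≤ s) (hs' : s ≤ (q - 1) / lam - 1)
    (hn : n = (q ^ m - 1) / lam)
    (β : K) (hβ : IsPrimitiveRoot β n)
    (hδ : 2 ≤ δ) (hδ' : δ ≤ n)
    (A : Matrix (Fin 2) (Fin 2) F) (hA : IsUnit A.det)
    (C' : Submodule F (Fin (2 * n) → F))
    (hC' : C' = BCH.matrixProductCode
      ![BCH.dualCode (BCH.narrowSenseBCH F n β δ), BCH.narrowSenseBCH F n β δ] A) :
    Module.finrank F C' = n ∧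
    (Odd m → A 0 0 ≠ 0 → A 0 1 ≠ 0 →
      ((δ : ℝ) = ((q : ℝ) ^ ((m + 1) / 2) - q) / lam + s + 1 →
        (q : ℝ) / 2 < lam * s → (lam * s : ℝ) ≤ q - √(lam * q / 2) →
        2 * (((q : ℝ) ^ ((m + 1) / 2) + lam - 1) / lam - s * (q : ℝ) ^ ((m - 1) / 2))
            ≤ BCH.minDist C' ∧
          √(2 * n) <
            2 * (((q : ℝ) ^ ((m + 1) / 2) + lam - 1) / lam - s * (q : ℝ) ^ ((m - 1) / 2))) ∧
      (((δ : ℝ) = ((q : ℝ) ^ ((m + 1) / 2) - q) / lam + s + 1 ∧ (lam * s : ℝ) ≤ (q : ℝ) / 2) ∨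
        (√(2 * lam * q) ≤ (lam * s - lam + 1 : ℝ) ∧
          ((q : ℝ) ^ ((m - 1) / 2) - 1) / lam + (s - 1) * (q : ℝ) ^ ((m - 1) / 2) < δ ∧
          (δ : ℝ) < ((q : ℝ) ^ ((m - 1) / 2) - 1 - lam) / lam + s * (q : ℝ) ^ ((m - 1) / 2)) ∨
        (√(4 * lam * q + lam ^ 2) < (q : ℝ) ∧
          ((q : ℝ) ^ ((m + 1) / 2) - 1) / lam - (q : ℝ) ^ ((m - 1) / 2) < δ ∧
          (δ : ℝ) ≤ ((q : ℝ) ^ ((m + 1) / 2) - q) / lam + 1) ∨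
        (lam = 1 ∧ 5 ≤ q ∧ √(2 * q) ≤ (s : ℝ) ∧ (s : ℝ) < q - 2 ∧
          s * (q : ℝ) ^ ((m - 1) / 2) ≤ δ ∧
          (δ : ℝ) ≤ (s + 1) * (q : ℝ) ^ ((m - 1) / 2) - s * (q : ℝ) ^ ((m - 3) / 2) - 2) →
        δ ≤ BCH.minDist C' ∧ √(2 * n) < (δ : ℝ))) := by
  have hfin : Module.finrank F C' = n := by
    rw [hC', BCH.finrank_matrixProductCode _ hA, Fin.sum_univ_two]
    exact BCH.finrank_add_finrank_dualCode _
  refine ⟨hfin, ?_⟩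
  rintro ⟨h, rfl⟩ hA₀ hA₁
  have hh : 1 ≤ h := by omega
  rw [show (2 * h + 1 + 1) / 2 = h + 1 by omega, show (2 * h + 1 - 1) / 2 = h by omega,
    show (2 * h + 1 - 3) / 2 = h - 1 by omega]
  have hq2 : 2 ≤ q := hq ▸ Fintype.one_lt_card
  obtain ⟨r, hr⟩ := hlam
  have hlam0 : 0 < lam := Nat.pos_of_ne_zero (by rintro rfl; omega)
  have hsr : s + 1 ≤ r := by
    rw [hr, Nat.mul_div_cancel_left _ hlam0] at hs'
    omega
  have hlsq : lam * s + lam + 1 ≤ q := by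
    have := Nat.mul_le_mul_left lam hsr
    rw [mul_add] at this
    omega
  have hlls : lam ≤ lam * s := Nat.le_mul_of_pos_right _ hs
  have hln : lam * n = q ^ (2 * h + 1) - 1 := by
    rw [hn]
    refine Nat.mul_div_cancel' ((Dvd.intro r hr.symm).trans ?_)
    simpa using Nat.sub_dvd_pow_sub_pow q 1 (2 * h + 1)
  clear hn hs' hm
  have hne : BCH.matrixProductCode
      ![BCH.dualCode (BCH.narrowSenseBCH F n β δ), BCH.narrowSenseBCH F n β δ] A ≠ ⊥ := by
    rw [← hC']
    rintro rfl
    rw [finrank_bot] at hfin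
    omega
  have hqQ : q ≤ q ^ h := Nat.le_self_pow (by omega) q
  have hdist := BCH.exists_hammingNorm_le_minDist_matrixProductCode _ hA hA₀ hA₁ hne
  rw [← hC'] at hdist
  have hdual := fun t B hδt htq htB hqB u =>
    BCH.le_mul_hammingNorm_of_mem_dualCode (t := t) (B := B) (u := u) (δ := δ)
      hq hK hh hlam0 hln hβ hδt htq htB hqB
  have hlR : (1 : ℝ) ≤ lam := by exact_mod_cast hlam0
  have hlR0 : (0 : ℝ) < lam := by linarith
  have hsR : (1 : ℝ) ≤ s := by exact_mod_cast hs
  have hlsqR : (lam * s + lam + 1 : ℝ) ≤ q := by exact_mod_cast hlsq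
  have hllsR : (lam : ℝ) ≤ lam * s := by exact_mod_cast hlls
  have hqR : (2 : ℝ) ≤ q := by exact_mod_cast hq2
  have hqQR : (q : ℝ) ≤ (q : ℝ) ^ h := by exact_mod_cast hqQ
  have hlnR : (lam * n : ℝ) = q * ((q : ℝ) ^ h) ^ 2 - 1 := by
    have h1 : lam * n + 1 = q ^ (2 * h + 1) := by
      rw [hln]
      exact Nat.sub_add_cancel (Nat.one_le_pow _ _ (by linarith))
    have h2 : (lam * n + 1 : ℝ) = (q : ℝ) ^ (2 * h + 1) := by exact_mod_cast h1
    rw [eq_sub_iff_add_eq, h2]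
    ring
  have hcast : ∀ t : ℕ, (lam * δ : ℝ) ≤ (q : ℝ) ^ h * q - q + t + lam →
      lam * (δ - 1) + q ≤ q ^ (h + 1) + t := by
    intro t ht
    have h1 : (lam * δ + q : ℝ) ≤ (q : ℝ) ^ (h + 1) + t + lam := by rw [pow_succ]; linarith
    have h2 : lam * δ + q ≤ q ^ (h + 1) + t + lam := by exact_mod_cast h1
    obtain ⟨e, rfl⟩ : ∃ e, δ = e + 1 := ⟨δ - 1, by omega⟩
    rw [mul_add] at h2
    rw [Nat.add_sub_cancel]
    omega
  have hdual_ls : (δ : ℝ) = ((q : ℝ) ^ (h + 1) - q) / lam + s + 1 →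
      (lam * δ : ℝ) = (q : ℝ) ^ h * q - q + lam * s + lam ∧
      ∀ u ∈ BCH.dualCode (BCH.narrowSenseBCH F n β δ), u ≠ 0 →
        ((q : ℝ) ^ h * q + lam : ℝ) ≤ lam * hammingNorm u + 1 + lam * s * (q : ℝ) ^ h := by
    intro hd
    have h1 : (lam * δ : ℝ) = (q : ℝ) ^ h * q - q + lam * s + lam := by
      rw [hd, pow_succ]; field_simp
    refine ⟨h1, fun u hu hu0 => ?_⟩
    -- Here `δ - 1` overshoots `(q^(h+1) - q)/λ` by `s`, so `t = λ s`, and `k = h` is the binding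
    -- rotation.
    have h2 := hdual (lam * s) (lam * s * q ^ h) (hcast _ (by push_cast; exact h1.le)) (by omega)
      le_rfl ((show q - 1 ≤ q ^ h by omega).trans
        (Nat.le_mul_of_pos_left _ (Nat.mul_pos hlam0 hs))) u hu hu0
    have h3 : ((q : ℝ) ^ (h + 1) + lam : ℝ) ≤
      lam * hammingNorm u + 1 + lam * s * (q : ℝ) ^ h := by exact_mod_cast h2
    rwa [pow_succ] at h3
  constructor
  · intro hd hls1 hls2
    obtain ⟨hld, hu⟩ := hdual_ls hd
    have hlx : (lam : ℝ) * (2 * (((q : ℝ) ^ (h + 1) + lam - 1) / lam - s * (q : ℝ) ^ h)) =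
        2 * ((q - lam * s) * (q : ℝ) ^ h + lam - 1) := by
      rw [pow_succ]; field_simp; ring
    set x : ℝ := 2 * (((q : ℝ) ^ (h + 1) + lam - 1) / lam - s * (q : ℝ) ^ h)
    set Q : ℝ := (q : ℝ) ^ h
    constructor
    · refine le_of_mul_le_mul_left ?_ hlR0
      rcases hdist with ⟨u, huC, hu0, hle⟩ | ⟨v, hvC, hv0, hle⟩
      · have h1 := hu u huC hu0
        have h2 : (2 * hammingNorm u : ℝ) ≤ BCH.minDist C' := by exact_mod_cast hle
        have h3 := mul_le_mul_of_nonneg_left h2 hlR0.le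
        rw [hlx]
        linarith
      · have h1 : (δ : ℝ) ≤ BCH.minDist C' := by
          exact_mod_cast (BCH.le_hammingNorm_of_mem_narrowSenseBCH hβ hvC hv0).trans hle
        have h2 := mul_le_mul_of_nonneg_left h1 hlR0.le
        -- Integrality sharpens `q < 2λs` by one; the extra `Q ≥ q` absorbs the lower-order terms,
        -- so `δ` exceeds the claimed bound.
        have h3 : (q + 1 : ℝ) ≤ 2 * (lam * s) := by
          have h4 : (q : ℝ) < 2 * (lam * s) := by linarith
          have h5 : q < 2 * (lam * s) := by exact_mod_cast h4
          exact_mod_cast h5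
        have h6 : (q + 1) * Q ≤ 2 * (lam * s) * Q := by gcongr
        rw [hlx]
        linarith
    · refine BCH.sqrt_lt_of_sqrt_le (w := 2 * (q - lam * s)) (by linarith) hlR0 (by linarith)
        ?_ hlnR (by rw [hlx]; linarith)
      rw [show (2 * lam * q : ℝ) = 2 ^ 2 * (lam * q / 2) by ring,
        Real.sqrt_mul (by positivity), Real.sqrt_sq (by norm_num)]
      linarith
  · intro hcases
    have hmin : (∀ u ∈ BCH.dualCode (BCH.narrowSenseBCH F n β δ), u ≠ 0 →
        (lam * δ : ℝ) ≤ 2 * (lam * hammingNorm u)) → δ ≤ BCH.minDist C' := by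
      intro hu
      rcases hdist with ⟨u, huC, hu0, hle⟩ | ⟨v, hvC, hv0, hle⟩
      · have h1 : lam * δ ≤ lam * (2 * hammingNorm u) := by
          have := hu u huC hu0
          rw [mul_left_comm] at this
          exact_mod_cast this
        exact (Nat.le_of_mul_le_mul_left h1 hlam0).trans hle
      · exact (BCH.le_hammingNorm_of_mem_narrowSenseBCH hβ hvC hv0).trans hle
    have hQqR : (q : ℝ) * q ≤ (q : ℝ) ^ h * q := by gcongr
    -- For such `δ` one may take `t = 0`, `B = q - 1`; dual words then already have weight at least
    -- `δ`, even without the factor two.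
    have hmin₀ : (lam * δ : ℝ) ≤ (q : ℝ) ^ h * q - q + lam → δ ≤ BCH.minDist C' := by
      intro hld
      refine hmin fun u huC hu0 => ?_
      have h1 := hdual 0 (q - 1) (hcast 0 (by simpa using hld)) (by omega) (by simp) le_rfl
        u huC hu0
      have h2 : q ^ (h + 1) + lam ≤ lam * hammingNorm u + q := by omega
      have h3 : ((q : ℝ) ^ (h + 1) + lam : ℝ) ≤ lam * hammingNorm u + q := by exact_mod_cast h2
      rw [pow_succ] at h3
      nlinarith
    rcases hcases with ⟨hd, hls⟩ | ⟨hw, hd, hd'⟩ | ⟨hw, hd, hd'⟩ | ⟨rfl, hq5, hw, hsq, hd, hd'⟩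
    · obtain ⟨hld, hu⟩ := hdual_ls hd
      refine ⟨hmin fun u huC hu0 => ?_,
        BCH.sqrt_lt_of_add_sub_eq (by linarith) hlR (by linarith) hllsR hqQR hlnR hld⟩
      have h1 := hu u huC hu0
      have h2 : lam * s * (q : ℝ) ^ h ≤ q / 2 * (q : ℝ) ^ h := by gcongr
      rw [hld]
      linarith
    · constructor
      · refine hmin₀ ?_
        have h1 : (lam * δ : ℝ) < (q : ℝ) ^ h - 1 - lam + lam * s * (q : ℝ) ^ h := by
          have h2 := mul_lt_mul_of_pos_left hd' hlR0
          rwa [mul_add, mul_div_cancel₀ _ hlR0.ne', ← mul_assoc] at h2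
        have h3 : (lam * s + lam + 1) * (q : ℝ) ^ h ≤ q * (q : ℝ) ^ h := by gcongr
        have h4 : 1 * (q : ℝ) ^ h ≤ lam * (q : ℝ) ^ h := by gcongr
        linarith
      · refine BCH.sqrt_lt_of_sqrt_le (by linarith) hlR0 (by linarith) hw hlnR ?_
        have h1 : ((q : ℝ) ^ h - 1) + lam * (s - 1) * (q : ℝ) ^ h < lam * δ := by
          have h2 := mul_lt_mul_of_pos_left hd hlR0
          rwa [mul_add, mul_div_cancel₀ _ hlR0.ne', ← mul_assoc] at h2
        -- Passing to integers turns the strict bound into `≤` and removes the `-1`, leaving a clean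
        -- multiple `(λs - λ + 1) Q`.
        have h3 : lam * s * q ^ h + q ^ h < lam * δ + 1 + lam * q ^ h := by
          have : (lam * s * (q : ℝ) ^ h + (q : ℝ) ^ h : ℝ) < lam * δ + 1 + lam * (q : ℝ) ^ h := by
            linarith
          exact_mod_cast this
        have h4 : (lam * s * (q : ℝ) ^ h + (q : ℝ) ^ h : ℝ) ≤ lam * δ + lam * (q : ℝ) ^ h := by
          have : lam * s * q ^ h + q ^ h ≤ lam * δ + lam * q ^ h := by omega
          exact_mod_cast this
        linarith
    · constructor
      · refine hmin₀ ?_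
        have h2 := mul_le_mul_of_nonneg_left hd' hlR0.le
        rw [mul_add, mul_div_cancel₀ _ hlR0.ne', pow_succ] at h2
        linarith
      · refine BCH.sqrt_lt_of_sqrt_le (w := q - lam) (by linarith) hlR0 (by linarith) ?_ hlnR ?_
        · have h1 : (4 * lam * q + lam ^ 2 : ℝ) < (q : ℝ) ^ 2 :=
            (Real.sqrt_lt' (by linarith)).1 hw
          -- The hypothesis gives `(q - λ)^2 > 2λq + 2λ^2`.
          refine Real.sqrt_le_iff.2 ⟨by linarith, ?_⟩
          nlinarith
        · have h1 : (q : ℝ) ^ h * q - 1 - lam * (q : ℝ) ^ h < lam * δ := by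
            have h2 := mul_lt_mul_of_pos_left hd hlR0
            rwa [mul_sub, mul_div_cancel₀ _ hlR0.ne', pow_succ] at h2
          have h3 : q ^ h * q < lam * δ + 1 + lam * q ^ h := by
            have : ((q : ℝ) ^ h * q : ℝ) < lam * δ + 1 + lam * (q : ℝ) ^ h := by linarith
            exact_mod_cast this
          have h4 : ((q : ℝ) ^ h * q : ℝ) ≤ lam * δ + lam * (q : ℝ) ^ h := by
            have : q ^ h * q ≤ lam * δ + lam * q ^ h := by omega
            exact_mod_cast this
          linarith
    · constructor
      · refine hmin₀ ?_
        have h1 : (s + 1) * (q : ℝ) ^ h ≤ (q - 1) * (q : ℝ) ^ h := by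
          gcongr
          linarith
        have h2 : 0 ≤ s * (q : ℝ) ^ (h - 1) := by positivity
        rw [Nat.cast_one, one_mul]
        linarith
      · refine BCH.sqrt_lt_of_sqrt_le (w := s) (by linarith) hlR0 (by linarith) ?_ hlnR ?_
        · simpa using hw
        · rw [Nat.cast_one, one_mul]
          exact hd
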